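/- Let $k$ be a finite field of cardinality $q^n$, let $k'$ be its subfield of cardinality $q$, and let $\alpha_0,\dots,\alpha_{n-1}$ be any basis of $k$ over $k'$. Notation. For a field $K$, a set $\mathcal G\subset S=K[X_0,\dots,X_{n-1}]$ and an integer $i\ge 0$, let $V_{\mathcal G,i}$ be the smallest $K$-vector space that contains every $f\in\mathcal G$ with $\deg f\le i$, and contains $hg$ whenever $g\in V_{\mathcal G,i}$, $h\in S$ and $\deg(hg)\le i$; put $V_{\mathcal G,\infty}=(\mathcal G)$. The last fall degree $d_{\mathcal G}$ is the least $d\in\mathbb Z_{\ge0}\cup\{\infty\}$ such that $f\in V_{\mathcal G,\max(d,\deg f)}$ for all $f$ in the ideal $(\mathcal G)$. For integers $r\ge 0$ and $c,t\ge1$ let $$\tau(r,c,t)=\max\Bigl(\Bigl\lfloor 2t(c-1)\Bigl(\log_c\frac{r}{2t}+1\Bigr)\Bigr\rfloor,\,0\Bigr),$$ with $\tau(0,c,t)=0$. For $f\in k[X]$ let $\overline f\in k[X_0,\dots,X_{n-1}]$ be obtained from the remainder of $f$ on division by $X^{q^n}-X$ by replacing each $X^e$, $e=\sum_{j<n}e_jq^j$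 with $0\le e_j<q$, by $X_0^{e_0}\cdots X_{n-1}^{e_{n-1}}$. Let $[f]_0,\dots,[f]_{n-1}\in k'[X_0,\dots,X_{n-1}]$ be the unique polynomials of degree at most $q-1$ in each variable such that $$f\Bigl(\sum_{j=0}^{n-1}\alpha_jX_j\Bigr)\equiv\sum_{j=0}^{n-1}[f]_j\,\alpha_j \pmod{X_j^q-X_j,\ j=0,\dots,n-1}.$$ For $\mathcal F\subset k[X]$, the Weil descent system of $\mathcal F$ together with the field equations is $$\mathcal F'_f=\{[f]_j: f\in\mathcal F,\ 0\le j<n\}\cup\{X_j^q-X_j: 0\le j<n\}\subset k'[X_0,\dots,X_{n-1}].$$ Theorem. Let $\mathcal F\subset k[X]$ be a finite subset and let $d\in\mathbb Z_{\ge0}$ be such that some nonzero $f\in\mathcal F$ has $\deg(f)\le d$, and such that $\deg(\overline g)\le\tau(2d,q,1)$ for all $g\in\mathcal F$. Then $$d_{\mathcal F'_f}\le\max(\tau(2d,q,1),\,q).$$ -/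

import Mathlib

namespace WeilDescent

/-! ### Constructible polynomials and the last fall degree -/

section LastFallDegree

variable {σ K : Type*} [Field K]

/-- `V F i` is the smallest `K`-vector space of polynomials containing all members of `F` of
degree `≤ i`, and containing `h * g` whenever it contains `g` and `deg (h * g) ≤ i`. -/
noncomputable def V (F : Set (MvPolynomial σ K)) (i : ℕ) : Submodule K (MvPolynomial σ K) :=
  sInf {W | (∀ f ∈ F, f.totalDegree ≤ i → f ∈ W) ∧
    ∀ g ∈ W, ∀ h : MvPolynomial σ K, (h * g).totalDegree ≤ i → h * g ∈ W}

/-- The least `d ∈ {0, 1, 2, …, ∞}` such that every `f` in the ideal generated by `F` lies in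
`V F (max d (deg f))`. (For `d = ∞` the condition always holds, as `V F ∞` is the whole ideal;
accordingly the infimum of the empty set is `⊤ = ∞`.) -/
noncomputable def lastFallDegree (F : Set (MvPolynomial σ K)) : ℕ∞ :=
  sInf ((fun d : ℕ => (d : ℕ∞)) ''
    {d : ℕ | ∀ f ∈ Ideal.span F, f ∈ V F (max d f.totalDegree)})

/-- The field equations `X_j ^ q - X_j`. -/
def fieldEquations (σ K : Type*) [Field K] (q : ℕ) : Set (MvPolynomial σ K) :=
  Set.range fun j : σ => MvPolynomial.X j ^ q - MvPolynomial.X j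

end LastFallDegree

/-! ### The function `τ` and the descended polynomial -/

/-- `τ(r, c, t) = max (⌊2 t (c - 1) (log_c (r / (2 t)) + 1)⌋, 0)`; for `r = 0` the logarithm is
`-∞` and the value is `0`. -/
noncomputable def tau (r c t : ℕ) : ℕ :=
  if r = 0 then 0
  else (max ⌊2 * (t : ℝ) * ((c : ℝ) - 1) * (Real.logb c ((r : ℝ) / (2 * (t : ℝ))) + 1)⌋ 0).toNat

/-- The descended polynomial `f̄` of `f ∈ k[X]`: divide `f` by `X ^ (q ^ n) - X`, and in the
remainder (which has degree `< q ^ n`) replace each `X ^ e`, where `e = ∑_{j < n} e_j q ^ j` in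
base `q`, by `X_0 ^ e_0 ⋯ X_{n-1} ^ e_{n-1}`. -/
noncomputable def descended {k : Type*} [Field k] (q n : ℕ) (f : Polynomial k) :
    MvPolynomial (Fin n) k :=
  (f %ₘ (Polynomial.X ^ (q ^ n) - Polynomial.X)).sum fun e a =>
    MvPolynomial.monomial (Finsupp.equivFunOnFinite.symm fun j : Fin n => e / q ^ (j : ℕ) % q) a

/-! ### The Weil descent system -/

section Weil

variable {k k' : Type*} [Field k'] [Field k] [Algebra k' k] {n : ℕ}

/-- `f (∑ j, α_j X_j)` as a polynomial over `k`. -/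
noncomputable def substBasis (α : Module.Basis (Fin n) k' k) (f : Polynomial k) :
    MvPolynomial (Fin n) k :=
  Polynomial.aeval (∑ j, MvPolynomial.C (α j) * MvPolynomial.X j) f

/-- `c_0, …, c_{n-1} ∈ k'[X_0, …, X_{n-1}]` are the components `[f]_0, …, [f]_{n-1}` of `f`:
`f (∑ j, α_j X_j) ≡ ∑ j, [f]_j α_j` modulo the field equations of `k'`, and every `[f]_j` is
reduced, i.e. has degree at most `q - 1` in each variable, where `q = #k'`. -/
structure IsWeilComponents (α : Module.Basis (Fin n) k' k) (f : Polynomial k)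
    (c : Fin n → MvPolynomial (Fin n) k') : Prop where
  congr : substBasis α f - ∑ j, MvPolynomial.C (α j) * MvPolynomial.map (algebraMap k' k) (c j) ∈
    Ideal.span (fieldEquations (Fin n) k (Nat.card k'))
  reduced : ∀ i j, (c j).degreeOf i ≤ Nat.card k' - 1

theorem exists_reduced_monomial {σ K : Type*} [Field K] (q : ℕ) (hq : 2 ≤ q) (a : K) (N : ℕ) :
    ∀ s : σ →₀ ℕ, s.degree = N → ∃ r : MvPolynomial σ K,
      MvPolynomial.monomial s a - r ∈ Ideal.span (fieldEquations σ K q) ∧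
      ∀ i, r.degreeOf i ≤ q - 1 := by
  classical
  induction N using Nat.strong_induction_on with
  | _ N ih =>
    intro s hs
    by_cases h : ∃ i, q ≤ s i
    · obtain ⟨i, hi⟩ := h
      set t : σ →₀ ℕ := s - Finsupp.single i q with ht
      have hst : s = t + Finsupp.single i q := by
        rw [ht, tsub_add_cancel_of_le]
        rwa [Finsupp.single_le_iff]
      have hdeg : (t + Finsupp.single i 1).degree < N := by
        rw [← hs, hst]
        simp only [map_add, Finsupp.degree_single]
        omega
      obtain ⟨r, hr, hr'⟩ := ih _ hdeg (t + Finsupp.single i 1) rfl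
      refine ⟨r, ?_, hr'⟩
      have hmem : MvPolynomial.monomial t a *
          (MvPolynomial.X i ^ q - MvPolynomial.X i : MvPolynomial σ K) ∈
          Ideal.span (fieldEquations σ K q) :=
        Ideal.mul_mem_left _ _ (Ideal.subset_span ⟨i, rfl⟩)
      have hsum := Ideal.add_mem _ hmem hr
      convert hsum using 1
      rw [hst, mul_sub, MvPolynomial.X_pow_eq_monomial, MvPolynomial.X,
        MvPolynomial.monomial_mul, MvPolynomial.monomial_mul]
      simp
    · push Not at h
      refine ⟨MvPolynomial.monomial s a, by simp, fun i => ?_⟩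
      rw [MvPolynomial.degreeOf_le_iff]
      intro m hm
      have := MvPolynomial.support_monomial_subset hm
      rw [Finset.mem_singleton] at this
      subst this
      have := h i
      omega

theorem exists_reduced {σ K : Type*} [Field K] (q : ℕ) (hq : 2 ≤ q) (p : MvPolynomial σ K) :
    ∃ r : MvPolynomial σ K, p - r ∈ Ideal.span (fieldEquations σ K q) ∧
      ∀ i, r.degreeOf i ≤ q - 1 := by
  induction p using MvPolynomial.induction_on' with
  | monomial s a => exact exists_reduced_monomial q hq a _ s rfl
  | add p₁ p₂ h₁ h₂ =>
    obtain ⟨r₁, h₁, h₁'⟩ := h₁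
    obtain ⟨r₂, h₂, h₂'⟩ := h₂
    refine ⟨r₁ + r₂, ?_, fun i => ?_⟩
    · convert Ideal.add_mem _ h₁ h₂ using 1
      ring
    · exact (MvPolynomial.degreeOf_add_le i r₁ r₂).trans (max_le (h₁' i) (h₂' i))

theorem exists_coordinates (α : Module.Basis (Fin n) k' k) (p : MvPolynomial (Fin n) k) :
    ∃ c : Fin n → MvPolynomial (Fin n) k',
      p = ∑ j, MvPolynomial.C (α j) * MvPolynomial.map (algebraMap k' k) (c j) := by
  induction p using MvPolynomial.induction_on' with
  | monomial s a =>
    refine ⟨fun j => MvPolynomial.monomial s (α.repr a j), ?_⟩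
    simp only [MvPolynomial.map_monomial, MvPolynomial.C_mul_monomial]
    rw [← map_sum]
    congr 1
    conv_lhs => rw [← α.sum_repr a]
    exact Finset.sum_congr rfl fun j _ => by rw [Algebra.smul_def, mul_comm]
  | add p₁ p₂ h₁ h₂ =>
    obtain ⟨c₁, h₁⟩ := h₁
    obtain ⟨c₂, h₂⟩ := h₂
    refine ⟨c₁ + c₂, ?_⟩
    rw [h₁, h₂, ← Finset.sum_add_distrib]
    exact Finset.sum_congr rfl fun j _ => by rw [Pi.add_apply, map_add, mul_add]

theorem exists_isWeilComponents [Finite k'] (α : Module.Basis (Fin n) k' k) (f : Polynomial k) :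
    ∃ c, IsWeilComponents α f c := by
  obtain ⟨c, hc⟩ := exists_coordinates α (substBasis α f)
  choose r hr hr' using fun j => exists_reduced (Nat.card k') Finite.one_lt_card (c j)
  refine ⟨r, ?_, fun i j => hr' j i⟩
  rw [hc, ← Finset.sum_sub_distrib]
  refine Ideal.sum_mem _ fun j _ => ?_
  rw [← mul_sub, ← map_sub]
  refine Ideal.mul_mem_left _ _ ?_
  have hmap := Ideal.mem_map_of_mem (MvPolynomial.map (algebraMap k' k)) (hr j)
  rw [Ideal.map_span] at hmap
  convert hmap using 2
  simp only [fieldEquations, ← Set.range_comp]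
  congr 1
  funext i
  simp

/-- The components are uniquely determined. -/
theorem IsWeilComponents.unique [Finite k'] {α : Module.Basis (Fin n) k' k} {f : Polynomial k}
    {c d : Fin n → MvPolynomial (Fin n) k'} (hc : IsWeilComponents α f c)
    (hd : IsWeilComponents α f d) : c = d := by
  classical
  have := Fintype.ofFinite k'
  have hmem := Ideal.sub_mem _ hd.congr hc.congr
  rw [sub_sub_sub_cancel_left, ← Finset.sum_sub_distrib] at hmem
  funext j
  refine sub_eq_zero.mp (MvPolynomial.eq_zero_of_eval_zero_at_prod_finset _
    (fun _ => Finset.univ) (fun i => ?_) (fun v _ => ?_))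
  · have h1 : (c j - d j).degreeOf i ≤ Nat.card k' - 1 :=
      (MvPolynomial.degreeOf_sub_le i _ _).trans (max_le (hc.reduced i j) (hd.reduced i j))
    have h2 : 0 < Nat.card k' := Nat.card_pos
    rw [Finset.card_univ, ← Nat.card_eq_fintype_card]
    omega
  · have hker : Ideal.span (fieldEquations (Fin n) k (Nat.card k')) ≤
        RingHom.ker (MvPolynomial.eval fun i => algebraMap k' k (v i)) := by
      rw [Ideal.span_le]
      rintro _ ⟨i, rfl⟩
      simp only [SetLike.mem_coe, RingHom.mem_ker, map_sub, map_pow, MvPolynomial.eval_X]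
      rw [← map_pow, Nat.card_eq_fintype_card, FiniteField.pow_card, sub_self]
    have h0 := hker hmem
    rw [RingHom.mem_ker, map_sum] at h0
    have h1 : ∑ i, (MvPolynomial.eval v (c i - d i)) • α i = 0 := by
      rw [← h0]
      refine Finset.sum_congr rfl fun i _ => ?_
      rw [← mul_sub, ← map_sub, map_mul, MvPolynomial.eval_C, Algebra.smul_def, mul_comm,
        MvPolynomial.eval_map]
      congr 1
      exact MvPolynomial.eval₂_comp_left (algebraMap k' k) (RingHom.id k') v (c i - d i)
    exact Fintype.linearIndependent_iff.mp α.linearIndependent _ h1 j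

/-- The component `[f]_j` of `f` with respect to the basis `α`. -/
noncomputable def weilComponent [Finite k'] (α : Module.Basis (Fin n) k' k) (f : Polynomial k)
    (j : Fin n) : MvPolynomial (Fin n) k' :=
  (exists_isWeilComponents α f).choose j

theorem weilComponent_spec [Finite k'] (α : Module.Basis (Fin n) k' k) (f : Polynomial k) :
    IsWeilComponents α f (weilComponent α f) :=
  (exists_isWeilComponents α f).choose_spec

/-- The Weil descent system `{[f]_j : f ∈ F, 0 ≤ j < n}`. -/
def weilDescent [Finite k'] (α : Module.Basis (Fin n) k' k) (F : Set (Polynomial k)) :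
    Set (MvPolynomial (Fin n) k') :=
  {p | ∃ f ∈ F, ∃ j, p = weilComponent α f j}

/-- The Weil descent system together with the field equations `X_j ^ q - X_j`, `q = #k'`. -/
def weilDescentWithFieldEquations [Finite k'] (α : Module.Basis (Fin n) k' k)
    (F : Set (Polynomial k)) : Set (MvPolynomial (Fin n) k') :=
  weilDescent α F ∪ fieldEquations (Fin n) k' (Nat.card k')

end Weil

end WeilDescent

/-! Extend scalars to `k` and substitute X_i ↦ ∑ α_j^{q^i} X_j. The relations X_i^q - X_{i+1}
(indices mod n) then become combinations of the field equations, and f̄ becomes ∑ [f]_j α_j up to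
field equations. The substitution and its inverse are linear, so degrees and constructibility carry
over (`V_twistedFieldEquations_le_comap`, `frobeniusSubst_descend_mem_V`), and constructibility over
`k` descends to `k'` (`mem_V_of_map_mem_V`). In the new coordinates, X_i ↦ X^{q^i} identifies
polynomials modulo the relations with k[X]/(X^{q^n} - X), where f̄ is the reduced representative of
f.

Let D be the claimed bound and W the space of polynomials constructible in degree D. Choose m ≠ 0 of
least degree with m̄ ∈ W. The given f of degree at most d forces deg m ≤ d, so polynomials of degree
at most deg m have descended forms of degree at most some T with 2T ≤ D (`two_mul_le_tau`).
Remainders mod m can therefore be multiplied and reduced again inside degree D. Building monomials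
one variable at a time, every p of degree at most D is congruent modulo W to the descended remainder
mod m of its univariate image (`sub_descend_ascend_mod_mem`). Minimality then gives m ∣ X^{q^n} - X
and m ∣ g for all g ∈ F (`exists_isDivisorOf`): m splits with simple roots, all of them common zeros
of F.

A member f of the ideal vanishes at these zeros, so m divides its univariate image. The remainder is
0, and the same congruence in degree max(D, deg f) shows that f is constructible there. -/

namespace WeilDescent

/-! ### Subspaces closed under multiplication of bounded degree -/

section Constructible

variable {σ τ K : Type*} [Field K]

/-- `W` contains `h * g` whenever it contains `g` and `h * g` has degree at most `i`. -/
def ClosedUpTo (W : Submodule K (MvPolynomial σ K)) (i : ℕ) : Prop :=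
  ∀ g ∈ W, ∀ h : MvPolynomial σ K, (h * g).totalDegree ≤ i → h * g ∈ W

theorem ClosedUpTo.mul_mem {W : Submodule K (MvPolynomial σ K)} {i : ℕ} (hW : ClosedUpTo W i)
    {g h : MvPolynomial σ K} (hg : g ∈ W) (hd : h.totalDegree + g.totalDegree ≤ i) :
    h * g ∈ W :=
  hW g hg h ((MvPolynomial.totalDegree_mul h g).trans hd)

theorem ClosedUpTo.mono {W : Submodule K (MvPolynomial σ K)} {i j : ℕ} (hW : ClosedUpTo W j)
    (hij : i ≤ j) : ClosedUpTo W i :=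
  fun g hg h hd => hW g hg h (hd.trans hij)

theorem closedUpTo_V (F : Set (MvPolynomial σ K)) (i : ℕ) : ClosedUpTo (V F i) i := by
  intro g hg h hd
  rw [V, Submodule.mem_sInf] at hg ⊢
  exact fun W hW => hW.2 g (hg W hW) h hd

theorem mem_V_of_mem {F : Set (MvPolynomial σ K)} {i : ℕ} {f : MvPolynomial σ K} (hf : f ∈ F)
    (hd : f.totalDegree ≤ i) : f ∈ V F i := by
  rw [V, Submodule.mem_sInf]
  exact fun W hW => hW.1 f hf hd

theorem V_le {F : Set (MvPolynomial σ K)} {i : ℕ} {W : Submodule K (MvPolynomial σ K)}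
    (hF : ∀ f ∈ F, f.totalDegree ≤ i → f ∈ W) (hW : ClosedUpTo W i) : V F i ≤ W :=
  sInf_le ⟨hF, hW⟩

theorem V_mono {F G : Set (MvPolynomial σ K)} (hFG : F ⊆ G) {i j : ℕ} (hij : i ≤ j) :
    V F i ≤ V G j :=
  V_le (fun _ hf hd => mem_V_of_mem (hFG hf) (hd.trans hij)) ((closedUpTo_V G j).mono hij)

theorem V_le_span (F : Set (MvPolynomial σ K)) (i : ℕ) :
    V F i ≤ (Ideal.span F).restrictScalars K :=
  V_le (fun _ hf _ => Ideal.subset_span hf) fun _ hg h _ => Ideal.mul_mem_left _ h hg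

theorem totalDegree_monomial_le_degree (s : σ →₀ ℕ) (a : K) :
    (MvPolynomial.monomial s a).totalDegree ≤ s.degree :=
  MvPolynomial.totalDegree_monomial_le s a

theorem totalDegree_aeval_le {L : τ → MvPolynomial σ K} (hL : ∀ i, (L i).totalDegree ≤ 1)
    (p : MvPolynomial τ K) : (MvPolynomial.aeval L p).totalDegree ≤ p.totalDegree := by
  classical
  rw [MvPolynomial.aeval_def, MvPolynomial.eval₂_eq]
  refine MvPolynomial.totalDegree_finsetSum_le fun s hs => ?_
  refine (MvPolynomial.totalDegree_mul _ _).trans ?_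
  rw [MvPolynomial.algebraMap_eq, MvPolynomial.totalDegree_C, zero_add]
  refine (MvPolynomial.totalDegree_finsetProd _ _).trans ?_
  refine le_trans (Finset.sum_le_sum fun i _ => ?_) (MvPolynomial.le_totalDegree hs)
  exact (MvPolynomial.totalDegree_pow _ _).trans (by simpa using Nat.mul_le_mul_left _ (hL i))

theorem ClosedUpTo.comap {W : Submodule K (MvPolynomial σ K)} {i : ℕ} (hW : ClosedUpTo W i)
    {L : τ → MvPolynomial σ K} (hL : ∀ i, (L i).totalDegree ≤ 1) :
    ClosedUpTo (W.comap (MvPolynomial.aeval L).toLinearMap) i := by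
  intro g hg h hd
  simp only [Submodule.mem_comap, AlgHom.toLinearMap_apply, map_mul] at hg ⊢
  refine hW _ hg _ ?_
  rw [← map_mul]
  exact (totalDegree_aeval_le hL _).trans hd

/-- The relations `X_j ^ q - X_{π j}`. -/
def twistedFieldEquations (K : Type*) [Field K] (π : σ → σ) (q : ℕ) : Set (MvPolynomial σ K) :=
  Set.range fun j : σ => MvPolynomial.X j ^ q - MvPolynomial.X (π j)

/-- Trading X_i^q for X_{π i} lowers the degree by q - 1 ≥ 1, so induction on the degree applies.
Two cases are needed: π = id for the field equations, and the cyclic shift for the relations in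
Frobenius coordinates. -/
theorem monomial_mem_reduced_sup_V (π : σ → σ) {q : ℕ} (hq : 2 ≤ q) (a : K) (N : ℕ) :
    ∀ s : σ →₀ ℕ, s.degree ≤ N → MvPolynomial.monomial s a ∈
      (MvPolynomial.restrictDegree σ K (q - 1) ⊓ MvPolynomial.restrictTotalDegree σ K N) ⊔
        V (twistedFieldEquations K π q) N := by
  classical
  suffices H : ∀ M ≤ N, ∀ s : σ →₀ ℕ, s.degree = M → MvPolynomial.monomial s a ∈
      (MvPolynomial.restrictDegree σ K (q - 1) ⊓ MvPolynomial.restrictTotalDegree σ K N) ⊔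
        V (twistedFieldEquations K π q) N from fun s hs => H _ hs s rfl
  intro M
  induction M using Nat.strong_induction_on with
  | _ M ih =>
    intro hM s hs
    by_cases h : ∃ i, q ≤ s i
    · obtain ⟨i, hi⟩ := h
      obtain ⟨t, rfl⟩ : ∃ t, s = t + Finsupp.single i q :=
        ⟨s - Finsupp.single i q, by rw [tsub_add_cancel_of_le]; rwa [Finsupp.single_le_iff]⟩
      simp only [map_add, Finsupp.degree_single] at hs
      have hdeg : (t + Finsupp.single (π i) 1).degree < M := by
        simp only [map_add, Finsupp.degree_single]
        omega
      have h1 := ih _ hdeg (by omega) _ rfl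
      have h2 : (MvPolynomial.X i ^ q - MvPolynomial.X (π i) : MvPolynomial σ K).totalDegree
          ≤ q := by
        refine (MvPolynomial.totalDegree_sub _ _).trans (max_le ?_ ?_)
        · rw [MvPolynomial.totalDegree_X_pow]
        · rw [MvPolynomial.totalDegree_X]; omega
      have h3 : MvPolynomial.monomial t a * (MvPolynomial.X i ^ q - MvPolynomial.X (π i)) ∈
          V (twistedFieldEquations K π q) N := by
        refine (closedUpTo_V _ _).mul_mem (mem_V_of_mem ⟨i, rfl⟩ (by omega)) ?_
        have := totalDegree_monomial_le_degree t a
        omega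
      convert add_mem (Submodule.mem_sup_right h3) h1 using 1
      rw [mul_sub, MvPolynomial.X_pow_eq_monomial, MvPolynomial.X,
        MvPolynomial.monomial_mul, MvPolynomial.monomial_mul]
      simp
    · push Not at h
      refine Submodule.mem_sup_left ⟨?_, ?_⟩
      · rw [SetLike.mem_coe, MvPolynomial.mem_restrictDegree]
        intro m hm i
        rw [Finset.mem_singleton.mp (MvPolynomial.support_monomial_subset hm)]
        have := h i
        omega
      · rw [SetLike.mem_coe, MvPolynomial.mem_restrictTotalDegree]
        have := totalDegree_monomial_le_degree s a
        omega

/-- Reduction modulo `X_j ^ q - X_{π j}` does not raise the degree, and happens in that degree. -/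
theorem exists_reduced_sub_mem_V (π : σ → σ) {q : ℕ} (hq : 2 ≤ q) {N : ℕ} {p : MvPolynomial σ K}
    (hp : p.totalDegree ≤ N) : ∃ r ∈ MvPolynomial.restrictDegree σ K (q - 1),
      r.totalDegree ≤ N ∧ p - r ∈ V (twistedFieldEquations K π q) N := by
  have : p ∈ (MvPolynomial.restrictDegree σ K (q - 1) ⊓ MvPolynomial.restrictTotalDegree σ K N) ⊔
        V (twistedFieldEquations K π q) N := by
    rw [p.as_sum]
    exact sum_mem fun s hs => monomial_mem_reduced_sup_V π hq _ N s
      ((MvPolynomial.le_totalDegree hs).trans hp)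
  obtain ⟨r, hr, v, hv, rfl⟩ := Submodule.mem_sup.mp this
  refine ⟨r, hr.1, (MvPolynomial.mem_restrictTotalDegree _ _ _).mp hr.2, ?_⟩
  rwa [add_sub_cancel_left]

end Constructible

/-! ### The descended polynomial -/

section Descended

variable {k : Type*} [Field k] {q n : ℕ}

theorem monic_X_pow_sub_X (h : 1 < q ^ n) :
    (Polynomial.X ^ (q ^ n) - Polynomial.X : Polynomial k).Monic := by
  refine (Polynomial.monic_X_pow _).sub_of_left ?_
  rw [Polynomial.degree_X, Polynomial.degree_X_pow]
  exact_mod_cast h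

theorem degree_X_pow_sub_X (h : 1 < q ^ n) :
    (Polynomial.X ^ (q ^ n) - Polynomial.X : Polynomial k).degree = (q ^ n : ℕ) := by
  rw [Polynomial.degree_sub_eq_left_of_degree_lt, Polynomial.degree_X_pow]
  rw [Polynomial.degree_X, Polynomial.degree_X_pow]
  exact_mod_cast h

/-- `f ↦ f̄` as a linear map. -/
noncomputable def descend (k : Type*) [Field k] (q n : ℕ) :
    Polynomial k →ₗ[k] MvPolynomial (Fin n) k :=
  Polynomial.lsum (fun e => MvPolynomial.monomial
    (Finsupp.equivFunOnFinite.symm fun j : Fin n => e / q ^ (j : ℕ) % q)) ∘ₗ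
  Polynomial.modByMonicHom (Polynomial.X ^ (q ^ n) - Polynomial.X)

theorem descend_apply (f : Polynomial k) : descend k q n f = descended q n f := rfl

theorem descend_eq_zero_of_dvd (h : 1 < q ^ n) {f : Polynomial k}
    (hf : Polynomial.X ^ (q ^ n) - Polynomial.X ∣ f) : descend k q n f = 0 := by
  have : f %ₘ (Polynomial.X ^ (q ^ n) - Polynomial.X) = 0 :=
    (Polynomial.modByMonic_eq_zero_iff_dvd (monic_X_pow_sub_X h)).mpr hf
  rw [descend_apply, descended, this, Polynomial.sum_zero_index]

theorem descend_eq_of_dvd_sub (h : 1 < q ^ n) {f g : Polynomial k}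
    (hfg : Polynomial.X ^ (q ^ n) - Polynomial.X ∣ f - g) : descend k q n f = descend k q n g := by
  rw [← sub_eq_zero, ← map_sub, descend_eq_zero_of_dvd h hfg]

theorem descend_monomial (h : 1 < q ^ n) {e : ℕ} (he : e < q ^ n) (a : k) :
    descend k q n (Polynomial.monomial e a) = MvPolynomial.monomial
      (Finsupp.equivFunOnFinite.symm fun j : Fin n => e / q ^ (j : ℕ) % q) a := by
  have : Polynomial.monomial e a %ₘ (Polynomial.X ^ (q ^ n) - Polynomial.X) =
      Polynomial.monomial e a := by
    rw [Polynomial.modByMonic_eq_self_iff (monic_X_pow_sub_X h), degree_X_pow_sub_X h]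
    exact (Polynomial.degree_monomial_le e a).trans_lt (by exact_mod_cast he)
  rw [descend_apply, descended, this, Polynomial.sum_monomial_index]
  simp

/-- `X_i ↦ X ^ (q ^ i)`. -/
noncomputable def ascend (k : Type*) [Field k] (q n : ℕ) :
    MvPolynomial (Fin n) k →ₐ[k] Polynomial k :=
  MvPolynomial.aeval fun i : Fin n => Polynomial.X ^ q ^ (i : ℕ)

theorem ascend_X (i : Fin n) : ascend k q n (MvPolynomial.X i) = Polynomial.X ^ q ^ (i : ℕ) :=
  MvPolynomial.aeval_X _ _

theorem ascend_monomial (s : Fin n →₀ ℕ) (a : k) :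
    ascend k q n (MvPolynomial.monomial s a) =
      Polynomial.monomial (∑ i, s i * q ^ (i : ℕ)) a := by
  rw [ascend, MvPolynomial.aeval_monomial, ← Polynomial.C_mul_X_pow_eq_monomial,
    Finsupp.prod_fintype _ _ (fun i => pow_zero _), ← Finset.prod_pow_eq_pow_sum]
  congr 1
  exact Finset.prod_congr rfl fun i _ => by rw [← pow_mul, mul_comm]

theorem ascend_descend (h : 1 < q ^ n) (f : Polynomial k) :
    ascend k q n (descend k q n f) = f %ₘ (Polynomial.X ^ (q ^ n) - Polynomial.X) := by
  rw [descend_apply, descended, Polynomial.sum_def, map_sum]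
  conv_rhs => rw [Polynomial.as_sum_support (f %ₘ _)]
  refine Finset.sum_congr rfl fun e he => ?_
  have he' : e < q ^ n := by
    have h1 := Polynomial.degree_modByMonic_lt f (monic_X_pow_sub_X (k := k) h)
    rw [degree_X_pow_sub_X h] at h1
    exact_mod_cast (Polynomial.le_degree_of_mem_supp e he).trans_lt h1
  rw [ascend_monomial]
  have h2 := finFunctionFinEquiv_apply (finFunctionFinEquiv.symm (⟨e, he'⟩ : Fin (q ^ n)))
  rw [Equiv.apply_symm_apply] at h2
  simp only [finFunctionFinEquiv_symm_apply_val] at h2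
  exact congrArg (fun i => Polynomial.monomial i _) h2.symm

theorem dvd_sub_ascend_descend (h : 1 < q ^ n) (f : Polynomial k) :
    Polynomial.X ^ (q ^ n) - Polynomial.X ∣ f - ascend k q n (descend k q n f) := by
  rw [ascend_descend h, Polynomial.modByMonic_eq_sub_mul_div, sub_sub_cancel]
  exact dvd_mul_right _ _

theorem descend_ascend_of_reduced (hq : 0 < q) (h : 1 < q ^ n) {r : MvPolynomial (Fin n) k}
    (hr : r ∈ MvPolynomial.restrictDegree (Fin n) k (q - 1)) :
    descend k q n (ascend k q n r) = r := by
  rw [MvPolynomial.mem_restrictDegree] at hr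
  conv_rhs => rw [r.as_sum]
  conv_lhs => rw [r.as_sum]
  rw [map_sum, map_sum]
  refine Finset.sum_congr rfl fun s hs => ?_
  have hs' : ∀ i, s i < q := fun i => by have := hr s hs i; omega
  have h2 := finFunctionFinEquiv_apply fun i => (⟨s i, hs' i⟩ : Fin q)
  rw [ascend_monomial, ← h2, descend_monomial h (Fin.is_lt _)]
  refine congrArg (fun t => MvPolynomial.monomial t _) (Finsupp.ext fun j => ?_)
  rw [Finsupp.equivFunOnFinite_symm_apply_apply, ← finFunctionFinEquiv_symm_apply_val,
    Equiv.symm_apply_apply]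

/-- An exponent e ≤ d has at most `Nat.log q d + 1` nonzero base-q digits, each at most q - 1, and
the degree of the descended monomial is the digit sum. -/
theorem totalDegree_descend_le (h : 1 < q ^ n) {d : ℕ} {f : Polynomial k} (hf : f.natDegree ≤ d) :
    (descend k q n f).totalDegree ≤ if d = 0 then 0 else (q - 1) * (Nat.log q d + 1) := by
  rw [descend_apply, descended, Polynomial.sum_def]
  refine MvPolynomial.totalDegree_finsetSum_le fun e he => ?_
  have hed : e ≤ d := by
    by_contra hlt
    have h1 : (f %ₘ (Polynomial.X ^ (q ^ n) - Polynomial.X)).degree ≤ f.degree :=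
      Polynomial.degree_modByMonic_le_left
    have h2 := (Polynomial.le_degree_of_mem_supp e he).trans
      (h1.trans (Polynomial.degree_le_natDegree.trans (Nat.cast_le.mpr hf)))
    exact hlt (by exact_mod_cast h2)
  refine (totalDegree_monomial_le_degree _ _).trans ?_
  rw [Finsupp.degree_eq_sum]
  simp only [Finsupp.equivFunOnFinite_symm_apply_apply]
  split_ifs with hd
  · obtain rfl : e = 0 := by omega
    simp
  · have hq : 1 < q := by
      by_contra hq
      exact absurd h (not_lt.mpr (pow_le_one' (by omega) n))
    calc ∑ j : Fin n, e / q ^ (j : ℕ) % q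
        = ∑ j ∈ Finset.range n, e / q ^ j % q :=
          (Finset.sum_range fun j => e / q ^ j % q).symm
      _ ≤ ∑ j ∈ Finset.range n, if j ∈ Finset.range (Nat.log q d + 1) then (q - 1) else 0 := by
          refine Finset.sum_le_sum fun j _ => ?_
          split_ifs with hj
          · have := Nat.mod_lt (e / q ^ j) (by omega : q > 0)
            omega
          · rw [Finset.mem_range, not_lt] at hj
            have : e < q ^ j := hed.trans_lt (Nat.lt_pow_of_log_lt hq hj)
            rw [Nat.div_eq_of_lt this, Nat.zero_mod]
      _ = ((Finset.range n).filter (· ∈ Finset.range (Nat.log q d + 1))).card * (q - 1) := by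
          rw [← Finset.sum_filter, Finset.sum_const, smul_eq_mul]
      _ ≤ (Nat.log q d + 1) * (q - 1) := by
          refine Nat.mul_le_mul_right _ ?_
          refine (Finset.card_le_card (t := Finset.range (Nat.log q d + 1)) ?_).trans_eq
            (Finset.card_range _)
          exact fun j hj => (Finset.mem_filter.mp hj).2
      _ = (q - 1) * (Nat.log q d + 1) := mul_comm _ _

/-- Each relation maps to 0, except the one that wraps around at i = n - 1, which maps to X^{q^n} -
X itself. -/
theorem dvd_of_mem_span_twisted [NeZero n] {p : MvPolynomial (Fin n) k}
    (hp : p ∈ Ideal.span (twistedFieldEquations k (fun i : Fin n => i + 1) q)) :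
    Polynomial.X ^ (q ^ n) - Polynomial.X ∣ ascend k q n p := by
  rw [← Ideal.mem_span_singleton, ← Ideal.mem_comap]
  refine (Ideal.span_le.mpr ?_) hp
  rintro _ ⟨i, rfl⟩
  simp only [SetLike.mem_coe, Ideal.mem_comap, map_sub, map_pow, ascend_X]
  rw [← pow_mul, ← pow_succ]
  obtain ⟨m, rfl⟩ : ∃ m, n = m + 1 := Nat.exists_eq_succ_of_ne_zero (NeZero.ne n)
  rcases eq_or_ne i (Fin.last m) with rfl | hi
  · rw [Fin.last_add_one]
    simp
  · rw [Fin.val_add_one_of_lt (Fin.lt_last_iff_ne_last.mpr hi), sub_self]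
    exact zero_mem _

/-- Reduced forms are unique because base-q digits are. Hence `descend ∘ ascend` computes the form
reached by the degree-bounded reduction. -/
theorem totalDegree_descend_ascend_le_and_sub_mem [NeZero n] (hq : 2 ≤ q) {N : ℕ}
    {p : MvPolynomial (Fin n) k} (hp : p.totalDegree ≤ N) :
    (descend k q n (ascend k q n p)).totalDegree ≤ N ∧
      p - descend k q n (ascend k q n p) ∈
        V (twistedFieldEquations k (fun i : Fin n => i + 1) q) N := by
  have h : 1 < q ^ n := Nat.one_lt_pow (NeZero.ne n) hq
  obtain ⟨r, hr, hrN, hpr⟩ := exists_reduced_sub_mem_V (fun i : Fin n => i + 1) hq hp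
  have h1 : descend k q n (ascend k q n p) = r := by
    rw [← descend_ascend_of_reduced (by omega) h hr]
    refine descend_eq_of_dvd_sub h ?_
    rw [← map_sub]
    exact dvd_of_mem_span_twisted (V_le_span _ _ hpr)
  rw [h1]
  exact ⟨hrN, hpr⟩

end Descended

end WeilDescent

namespace WeilDescent

/-! ### Division with remainder inside a constructible subspace -/

section Division

variable {k : Type*} [Field k] {q n : ℕ}

/-- The polynomial `m` has its descended form in a subspace `W`, closed up to degree `D` and
containing the relations `X_i ^ q - X_{i+1}`, where `D` is large compared to `deg m`. -/
structure IsDivisorOf (q n : ℕ) [NeZero n] (W : Submodule k (MvPolynomial (Fin n) k)) (D T : ℕ)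
    (m : Polynomial k) : Prop where
  two_le : 2 ≤ q
  le_bound : q ≤ D
  closed : ClosedUpTo W D
  relations : V (twistedFieldEquations k (fun i : Fin n => i + 1) q) D ≤ W
  degree_le : ∀ p : Polynomial k, p.natDegree ≤ m.natDegree → (descend k q n p).totalDegree ≤ T
  two_mul_le : 2 * T ≤ D
  add_one_le : T + 1 ≤ D
  ne_zero : m ≠ 0
  mem : descend k q n m ∈ W

variable [NeZero n] {W W' : Submodule k (MvPolynomial (Fin n) k)} {D D' T : ℕ} {m : Polynomial k}

theorem natDegree_mod_le (p : Polynomial k) {m : Polynomial k} (hm : m ≠ 0) :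
    (p % m).natDegree ≤ m.natDegree :=
  Polynomial.natDegree_le_natDegree (EuclideanDomain.mod_lt p hm).le

theorem natDegree_div_le (p : Polynomial k) {m : Polynomial k} (hm : m ≠ 0) :
    (p / m).natDegree ≤ p.natDegree - m.natDegree := by
  rw [Polynomial.div_def]
  refine (Polynomial.natDegree_C_mul_le _ _).trans ?_
  rw [Polynomial.natDegree_divByMonic _ (Polynomial.monic_mul_leadingCoeff_inv hm),
    Polynomial.natDegree_mul_leadingCoeff_inv _ hm]

theorem smul_mod (c : k) (p m : Polynomial k) : (c • p) % m = c • (p % m) := by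
  simp only [Polynomial.mod_def, Polynomial.smul_modByMonic]

namespace IsDivisorOf

theorem mono (h : IsDivisorOf q n W D T m) (hD : D ≤ D') (hW' : ClosedUpTo W' D') (hWW' : W ≤ W')
    (hrel : V (twistedFieldEquations k (fun i : Fin n => i + 1) q) D' ≤ W') :
    IsDivisorOf q n W' D' T m :=
  ⟨h.two_le, h.le_bound.trans hD, hW', hrel, h.degree_le, h.two_mul_le.trans hD,
    h.add_one_le.trans hD, h.ne_zero, hWW' h.mem⟩

theorem one_lt (h : IsDivisorOf q n W D T m) : 1 < q ^ n := Nat.one_lt_pow (NeZero.ne n) h.two_le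

theorem sub_descend_ascend_mem (h : IsDivisorOf q n W D T m) {p : MvPolynomial (Fin n) k}
    (hp : p.totalDegree ≤ D) : p - descend k q n (ascend k q n p) ∈ W :=
  h.relations (totalDegree_descend_ascend_le_and_sub_mem h.two_le hp).2

theorem descend_mul_sub_mem (h : IsDivisorOf q n W D T m) {p s : Polynomial k}
    (hps : (descend k q n p).totalDegree + (descend k q n s).totalDegree ≤ D) :
    descend k q n p * descend k q n s - descend k q n (p * s) ∈ W := by
  have h1 := h.sub_descend_ascend_mem ((MvPolynomial.totalDegree_mul _ _).trans hps)
  convert h1 using 2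
  refine descend_eq_of_dvd_sub h.one_lt ?_
  obtain ⟨a, ha⟩ := dvd_sub_ascend_descend h.one_lt p
  obtain ⟨b, hb⟩ := dvd_sub_ascend_descend h.one_lt s
  rw [map_mul]
  refine ⟨a * s + ascend k q n (descend k q n p) * b, ?_⟩
  linear_combination s * ha + ascend k q n (descend k q n p) * hb

/-- Since m̄ ∈ W, the product of m̄ with the descended quotient lies in W as soon as the degrees
fit. That product represents p - p % m. -/
theorem descend_sub_descend_mod_mem (h : IsDivisorOf q n W D T m) {p : Polynomial k}
    (hp : (descend k q n (p / m)).totalDegree + T ≤ D) :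
    descend k q n p - descend k q n (p % m) ∈ W := by
  have h0 : (descend k q n (p / m)).totalDegree + (descend k q n m).totalDegree ≤ D :=
    (Nat.add_le_add_left (h.degree_le m le_rfl) _).trans hp
  have h1 := h.closed.mul_mem h.mem h0
  have h2 := sub_mem h1 (h.descend_mul_sub_mem h0)
  rw [sub_sub_cancel] at h2
  convert h2 using 1
  rw [← map_sub]
  congr 1
  linear_combination -EuclideanDomain.div_add_mod p m

/-- The quotient by m has degree at most 1, so its descended form is linear and T + 1 ≤ D is room
enough. The bound T need not cover this quotient when m is constant. -/
theorem sub_descend_mod_mem_of_natDegree_le_one (h : IsDivisorOf q n W D T m)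
    {p : MvPolynomial (Fin n) k} (hp : p.totalDegree ≤ D)
    (hp' : (ascend k q n p).natDegree ≤ 1) :
    p - descend k q n (ascend k q n p % m) ∈ W := by
  have h1 : (descend k q n (ascend k q n p / m)).totalDegree ≤ 1 := by
    have h2 : (ascend k q n p / m).natDegree ≤ 1 :=
      (Polynomial.natDegree_le_natDegree (Polynomial.degree_div_le _ _)).trans hp'
    obtain ⟨a, b, hab⟩ := Polynomial.exists_eq_X_add_C_of_natDegree_le_one h2
    have h3 : ascend k q n p / m = ascend k q n (MvPolynomial.C a * MvPolynomial.X 0 +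
        MvPolynomial.C b) := by
      rw [hab, map_add, map_mul, ascend_X, ← MvPolynomial.algebraMap_eq, AlgHom.commutes,
        AlgHom.commutes]
      simp
    rw [h3]
    refine (totalDegree_descend_ascend_le_and_sub_mem h.two_le ?_).1
    refine (MvPolynomial.totalDegree_add _ _).trans (max_le ?_ (by simp))
    refine (MvPolynomial.totalDegree_mul _ _).trans ?_
    simp
  have h4 := h.descend_sub_descend_mod_mem (p := ascend k q n p)
    (by have := h.add_one_le; omega)
  simpa using add_mem (h.sub_descend_ascend_mem hp) h4

/-- A product of two remainders has degree at most 2 deg m, so its quotient by m is again covered by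
T. Both the product and the division then fit because 2T ≤ D. -/
theorem descend_mod_mul_sub_mem (h : IsDivisorOf q n W D T m) (p s : Polynomial k) :
    descend k q n (p % m) * descend k q n (s % m) - descend k q n (p * s % m) ∈ W := by
  have hp := natDegree_mod_le p h.ne_zero
  have hs := natDegree_mod_le s h.ne_zero
  have h1 := h.descend_mul_sub_mem (p := p % m) (s := s % m) (by
    have := h.degree_le _ hp
    have := h.degree_le _ hs
    have := h.two_mul_le
    omega)
  have h2 : ((p % m * (s % m)) / m).natDegree ≤ m.natDegree := by
    have := natDegree_div_le (p % m * (s % m)) h.ne_zero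
    have := Polynomial.natDegree_mul_le (p := p % m) (q := s % m)
    omega
  have h3 := h.descend_sub_descend_mod_mem (p := p % m * (s % m)) (by
    have := h.degree_le _ h2
    have := h.two_mul_le
    omega)
  rw [Polynomial.mul_mod]
  simpa using add_mem h1 h3

/-- With l̄ and μ̄ the descended remainders, LM - l̄μ̄ = L(M - μ̄) + μ̄(L - l̄). The first term fits
in degree D since L is linear, the second since T + max(1, T) ≤ D. -/
theorem mul_sub_descend_mod_mem (h : IsDivisorOf q n W D T m) {L M : MvPolynomial (Fin n) k}
    {l μ : Polynomial k} (hL : L.totalDegree ≤ 1) (hLl : L - descend k q n (l % m) ∈ W)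
    (hM : M.totalDegree + 1 ≤ D) (hMμ : M - descend k q n (μ % m) ∈ W) :
    L * M - descend k q n (l * μ % m) ∈ W := by
  have hl := h.degree_le _ (natDegree_mod_le l h.ne_zero)
  have hμ := h.degree_le _ (natDegree_mod_le μ h.ne_zero)
  have hT := h.add_one_le
  have hT' := h.two_mul_le
  have h1 : L * (M - descend k q n (μ % m)) ∈ W := by
    refine h.closed.mul_mem hMμ ?_
    have := MvPolynomial.totalDegree_sub M (descend k q n (μ % m))
    omega
  have h2 : descend k q n (μ % m) * (L - descend k q n (l % m)) ∈ W := by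
    refine h.closed.mul_mem hLl ?_
    have := MvPolynomial.totalDegree_sub L (descend k q n (l % m))
    rcases Nat.eq_zero_or_pos T with h0 | h0 <;> omega
  convert add_mem (add_mem h1 h2) (h.descend_mod_mul_sub_mem l μ) using 1
  ring

theorem one_sub_descend_mod_mem (h : IsDivisorOf q n W D T m) :
    1 - descend k q n (1 % m) ∈ W := by
  have := h.sub_descend_mod_mem_of_natDegree_le_one (p := 1) (by simp) (by simp)
  rwa [map_one] at this

theorem pow_sub_descend_mod_mem (h : IsDivisorOf q n W D T m) {L : MvPolynomial (Fin n) k}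
    {l : Polynomial k} (hL : L.totalDegree ≤ 1) (hLl : L - descend k q n (l % m) ∈ W) {a : ℕ}
    (ha : a ≤ D) : L ^ a - descend k q n (l ^ a % m) ∈ W := by
  induction a with
  | zero => simpa using h.one_sub_descend_mod_mem
  | succ a ih =>
    rw [pow_succ', pow_succ']
    refine h.mul_sub_descend_mod_mem hL hLl ?_ (ih (by omega))
    have h1 := MvPolynomial.totalDegree_pow L a
    have h2 := Nat.mul_le_mul_left a hL
    omega

/-- Each step takes a q-th power, which needs only degree q ≤ D, and then applies X_i^q ≡ X_{i+1}.
The index runs over all of ℕ, read mod n, so that i = n returns to X_0. -/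
theorem X_sub_descend_mod_mem (h : IsDivisorOf q n W D T m) (i : ℕ) :
    MvPolynomial.X (Fin.ofNat n i) - descend k q n (Polynomial.X ^ q ^ i % m) ∈ W := by
  induction i with
  | zero =>
    have h0 : Fin.ofNat n 0 = 0 := rfl
    have := h.sub_descend_mod_mem_of_natDegree_le_one (p := MvPolynomial.X 0)
      (by rw [MvPolynomial.totalDegree_X]; have := h.add_one_le; omega) (by simp [ascend_X])
    simpa [ascend_X, h0] using this
  | succ i ih =>
    have h1 := h.pow_sub_descend_mod_mem (MvPolynomial.totalDegree_X _).le ih h.le_bound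
    rw [← pow_mul, ← pow_succ] at h1
    have h2 : MvPolynomial.X (Fin.ofNat n i) ^ q - MvPolynomial.X (Fin.ofNat n (i + 1)) ∈ W := by
      refine h.relations (mem_V_of_mem ⟨Fin.ofNat n i, ?_⟩ ?_)
      · simp only [sub_right_inj]
        congr 1
        simp [Fin.ext_iff, Fin.val_add]
      · refine (MvPolynomial.totalDegree_sub _ _).trans (max_le ?_ ?_)
        · rw [MvPolynomial.totalDegree_X_pow]; exact h.le_bound
        · rw [MvPolynomial.totalDegree_X]; have := h.add_one_le; omega
    simpa using sub_mem h1 h2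

theorem sub_descend_ascend_mod_mem (h : IsDivisorOf q n W D T m) {p : MvPolynomial (Fin n) k}
    (hp : p.totalDegree ≤ D) : p - descend k q n (ascend k q n p % m) ∈ W := by
  classical
  have hX : ∀ i : Fin n, MvPolynomial.X i -
      descend k q n (ascend k q n (MvPolynomial.X i) % m) ∈ W := fun i => by
    simpa [ascend_X] using h.X_sub_descend_mod_mem i
  have hmon : ∀ N ≤ D, ∀ s : Fin n →₀ ℕ, s.degree = N →
      MvPolynomial.monomial s 1 -
        descend k q n (ascend k q n (MvPolynomial.monomial s 1) % m) ∈ W := by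
    intro N
    induction N with
    | zero =>
      intro _ s hs
      obtain rfl := (Finsupp.degree_eq_zero_iff s).mp hs
      simpa using h.one_sub_descend_mod_mem
    | succ N ih =>
      intro hN s hs
      obtain ⟨i, hi⟩ : ∃ i, s i ≠ 0 := by
        by_contra! hall
        rw [show s = 0 from Finsupp.ext hall] at hs
        simp at hs
      obtain ⟨t, rfl⟩ : ∃ t, s = t + Finsupp.single i 1 :=
        ⟨s - Finsupp.single i 1, by
          rw [tsub_add_cancel_of_le]; rw [Finsupp.single_le_iff]; omega⟩
      simp only [map_add, Finsupp.degree_single, Nat.add_right_cancel_iff] at hs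
      have h1 : MvPolynomial.monomial (t + Finsupp.single i 1) (1 : k) =
          MvPolynomial.X i * MvPolynomial.monomial t 1 := by
        rw [MvPolynomial.X, MvPolynomial.monomial_mul, add_comm, one_mul]
      rw [h1, map_mul]
      refine h.mul_sub_descend_mod_mem (MvPolynomial.totalDegree_X _).le (hX i) ?_
        (ih (by omega) t hs)
      have := totalDegree_monomial_le_degree t (1 : k)
      omega
  -- Both sides are linear in p; restricting to subsets of the support keeps every monomial within
  -- degree D.
  have hsum : ∀ S ⊆ p.support, (∑ s ∈ S, MvPolynomial.monomial s (p.coeff s)) -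
      descend k q n (ascend k q n (∑ s ∈ S, MvPolynomial.monomial s (p.coeff s)) % m) ∈ W := by
    intro S
    induction S using Finset.induction_on with
    | empty => simp
    | insert s S hs ih =>
      intro hS
      rw [Finset.insert_subset_iff] at hS
      rw [Finset.sum_insert hs, map_add, Polynomial.add_mod, map_add, add_sub_add_comm]
      refine add_mem ?_ (ih hS.2)
      have h1 := W.smul_mem (p.coeff s) (hmon _ ((MvPolynomial.le_totalDegree hS.1).trans hp) s rfl)
      rw [smul_sub, MvPolynomial.smul_monomial, smul_eq_mul, mul_one, ← map_smul, ← smul_mod,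
        ← map_smul, MvPolynomial.smul_monomial, smul_eq_mul, mul_one] at h1
      exact h1
  have := hsum _ subset_rfl
  rwa [← p.as_sum] at this

end IsDivisorOf

/-- Euclid's algorithm can be carried out inside `W`. -/
theorem exists_isDivisorOf (hq : 2 ≤ q) (hqD : q ≤ D) (hW : ClosedUpTo W D)
    (hrel : V (twistedFieldEquations k (fun i : Fin n => i + 1) q) D ≤ W) {d : ℕ}
    (hT : ∀ p : Polynomial k, p.natDegree ≤ d → (descend k q n p).totalDegree ≤ T)
    (h2T : 2 * T ≤ D) (hT1 : T + 1 ≤ D) {f : Polynomial k} (hf : f ≠ 0) (hfd : f.natDegree ≤ d)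
    (hfW : descend k q n f ∈ W) :
    ∃ m, IsDivisorOf q n W D T m ∧ m ∣ Polynomial.X ^ (q ^ n) - Polynomial.X ∧
      ∀ g, (descend k q n g).totalDegree ≤ D → descend k q n g ∈ W → m ∣ g := by
  classical
  have hex : ∃ e, ∃ m : Polynomial k, m ≠ 0 ∧ m.natDegree = e ∧ descend k q n m ∈ W :=
    ⟨_, f, hf, rfl, hfW⟩
  obtain ⟨m, hm0, hmdeg, hmW⟩ := Nat.find_spec hex
  -- A nonzero remainder whose descended form lies in W would contradict the minimal degree of m.
  have hmin : ∀ p, descend k q n (p % m) ∈ W → m ∣ p := by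
    intro p hp
    by_contra hdvd
    have h0 : p % m ≠ 0 := fun h => hdvd ((EuclideanDomain.mod_eq_zero).mp h)
    have h1 := Nat.find_min' hex ⟨p % m, h0, rfl, hp⟩
    rw [← hmdeg] at h1
    exact absurd (Polynomial.natDegree_lt_natDegree h0 (EuclideanDomain.mod_lt p hm0))
      (not_lt.mpr h1)
  have hmd : m.natDegree ≤ d := by
    rw [hmdeg]
    exact (Nat.find_min' hex ⟨f, hf, rfl, hfW⟩).trans hfd
  have h : IsDivisorOf q n W D T m :=
    ⟨hq, hqD, hW, hrel, fun p hp => hT p (hp.trans hmd), h2T, hT1, hm0, hmW⟩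
  have hX : m ∣ Polynomial.X ^ (q ^ n) - Polynomial.X := by
    refine hmin _ ?_
    -- X_0 is congruent both to the remainder of X and, after going once round the cycle, to that of
    -- X^{q^n}.
    have h1 := sub_mem (h.X_sub_descend_mod_mem 0) (h.X_sub_descend_mod_mem n)
    have h2 : Fin.ofNat n n = Fin.ofNat n 0 := by simp
    rw [h2, sub_sub_sub_cancel_left, ← map_sub, ← Polynomial.sub_mod, pow_zero, pow_one] at h1
    exact h1
  refine ⟨m, h, hX, fun g hgD hg => hmin g ?_⟩
  have h1 := sub_mem hg (h.sub_descend_ascend_mod_mem hgD)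
  rw [sub_sub_cancel] at h1
  rwa [Polynomial.mod_eq_of_dvd_sub (hX.trans (dvd_sub_ascend_descend h.one_lt g))]

end Division

end WeilDescent

namespace WeilDescent

/-! ### Extension of scalars -/

section BaseChange

variable {σ k k' : Type*} [Field k'] [Field k] [Algebra k' k]

/-- Apply a linear functional to all coefficients. -/
noncomputable def coeffMap (l : k →ₗ[k'] k') (p : MvPolynomial σ k) : MvPolynomial σ k' :=
  ∑ s ∈ p.support, MvPolynomial.monomial s (l (p.coeff s))

theorem coeff_coeffMap (l : k →ₗ[k'] k') (p : MvPolynomial σ k) (s : σ →₀ ℕ) :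
    (coeffMap l p).coeff s = l (p.coeff s) := by
  classical
  simp only [coeffMap, MvPolynomial.coeff_sum, MvPolynomial.coeff_monomial, Finset.sum_ite_eq',
    MvPolynomial.mem_support_iff]
  split_ifs with h
  · rfl
  · rw [not_not.mp h, map_zero]

theorem coeffMap_add (l : k →ₗ[k'] k') (p r : MvPolynomial σ k) :
    coeffMap l (p + r) = coeffMap l p + coeffMap l r := by
  ext s
  simp only [coeff_coeffMap, MvPolynomial.coeff_add, map_add]

theorem coeffMap_zero (l : k →ₗ[k'] k') : coeffMap l (0 : MvPolynomial σ k) = 0 := by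
  ext s
  simp only [coeff_coeffMap, MvPolynomial.coeff_zero, map_zero]

theorem coeffMap_monomial_mul (l : k →ₗ[k'] k') (s : σ →₀ ℕ) (a : k) (p : MvPolynomial σ k) :
    coeffMap l (MvPolynomial.monomial s a * p) =
      MvPolynomial.monomial s 1 * coeffMap (l ∘ₗ LinearMap.mulLeft k' a) p := by
  classical
  ext t
  rw [coeff_coeffMap, MvPolynomial.coeff_monomial_mul', MvPolynomial.coeff_monomial_mul']
  split_ifs
  · rw [coeff_coeffMap, one_mul, LinearMap.comp_apply, LinearMap.mulLeft_apply]
  · rw [map_zero]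

theorem coeffMap_map (l : k →ₗ[k'] k') (p : MvPolynomial σ k') :
    coeffMap l (MvPolynomial.map (algebraMap k' k) p) = l 1 • p := by
  ext s
  rw [coeff_coeffMap, MvPolynomial.coeff_map, MvPolynomial.coeff_smul, Algebra.algebraMap_eq_smul_one,
    map_smul, smul_eq_mul, smul_eq_mul, mul_comm]

theorem totalDegree_coeffMap_le (l : k →ₗ[k'] k') (p : MvPolynomial σ k) :
    (coeffMap l p).totalDegree ≤ p.totalDegree :=
  MvPolynomial.totalDegree_finsetSum_le fun s hs =>
    (totalDegree_monomial_le_degree s _).trans (MvPolynomial.le_totalDegree hs)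

/-- Polynomials all of whose coordinates lie in `W`. -/
noncomputable def extendScalars (k : Type*) [Field k] [Algebra k' k]
    (W : Submodule k' (MvPolynomial σ k')) : Submodule k (MvPolynomial σ k) where
  carrier := {p | ∀ l : k →ₗ[k'] k', coeffMap l p ∈ W}
  add_mem' hp hr l := by rw [coeffMap_add]; exact add_mem (hp l) (hr l)
  zero_mem' l := by rw [coeffMap_zero]; exact zero_mem W
  smul_mem' a p hp l := by
    have := hp (l ∘ₗ LinearMap.mulLeft k' a)
    convert this using 1
    ext s
    simp [coeff_coeffMap]

theorem ClosedUpTo.extendScalars {W : Submodule k' (MvPolynomial σ k')} {i : ℕ}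
    (hW : ClosedUpTo W i) : ClosedUpTo (extendScalars k W) i := by
  intro g hg h hd
  rcases eq_or_ne g 0 with rfl | hg0
  · rw [mul_zero]; exact zero_mem _
  rcases eq_or_ne h 0 with rfl | hh0
  · rw [zero_mul]; exact zero_mem _
  -- Degrees add exactly over a domain, so every single monomial of h times g stays within the
  -- bound.
  rw [MvPolynomial.totalDegree_mul_of_isDomain hh0 hg0] at hd
  rw [h.as_sum, Finset.sum_mul]
  refine sum_mem fun s hs l => ?_
  rw [coeffMap_monomial_mul]
  refine hW.mul_mem (hg _) (le_trans (Nat.add_le_add ?_ (totalDegree_coeffMap_le _ g)) hd)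
  exact (totalDegree_monomial_le_degree s 1).trans (MvPolynomial.le_totalDegree hs)

theorem totalDegree_map_algebraMap (p : MvPolynomial σ k') :
    (MvPolynomial.map (algebraMap k' k) p).totalDegree = p.totalDegree := by
  simp only [MvPolynomial.totalDegree,
    MvPolynomial.support_map_of_injective p (algebraMap k' k).injective]

/-- Constructibility descends along extensions of the base field. -/
theorem mem_V_of_map_mem_V {F : Set (MvPolynomial σ k')} {i : ℕ} {f : MvPolynomial σ k'}
    (hf : MvPolynomial.map (algebraMap k' k) f ∈ V (MvPolynomial.map (algebraMap k' k) '' F) i) :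
    f ∈ V F i := by
  have h1 : V (MvPolynomial.map (algebraMap k' k) '' F) i ≤ extendScalars k (V F i) := by
    refine V_le ?_ (closedUpTo_V F i).extendScalars
    rintro _ ⟨g, hg, rfl⟩ hd l
    rw [coeffMap_map]
    rw [totalDegree_map_algebraMap] at hd
    exact Submodule.smul_mem _ _ (mem_V_of_mem hg hd)
  -- A functional with l(1) = 1 recovers f from its image over `k`.
  obtain ⟨l, hl⟩ : ∃ l : k →ₗ[k'] k', l ∘ₗ Algebra.linearMap k' k = LinearMap.id :=
    LinearMap.exists_leftInverse_of_injective _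
      (LinearMap.ker_eq_bot.mpr (algebraMap k' k).injective)
  have h2 := h1 hf l
  have h3 : l 1 = 1 := by simpa using LinearMap.congr_fun hl 1
  rwa [coeffMap_map, h3, one_smul] at h2

end BaseChange

/-! ### The linear change of coordinates -/

section Coordinates

variable {k k' : Type*} [Field k'] [Field k] [Algebra k' k] {n : ℕ}

/-- The linear forms `∑ j, α_j ^ (q ^ i) X_j`. -/
noncomputable def frobeniusForm (q : ℕ) (α : Module.Basis (Fin n) k' k) (i : ℕ) :
    MvPolynomial (Fin n) k :=
  ∑ j, MvPolynomial.C (α j ^ q ^ i) * MvPolynomial.X j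

theorem totalDegree_sum_C_mul_X_le (a : Fin n → k) :
    (∑ j, MvPolynomial.C (a j) * MvPolynomial.X j : MvPolynomial (Fin n) k).totalDegree ≤ 1 := by
  refine MvPolynomial.totalDegree_finsetSum_le fun j _ => ?_
  refine (MvPolynomial.totalDegree_mul _ _).trans ?_
  simp

theorem sum_smul_pow_card [Finite k'] (x : Fin n → k) (c : Fin n → k') (i : ℕ) :
    (∑ j, x j * algebraMap k' k (c j)) ^ Nat.card k' ^ i =
      ∑ j, x j ^ Nat.card k' ^ i * algebraMap k' k (c j) := by
  have := Fintype.ofFinite k'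
  induction i with
  | zero => simp
  | succ i ih =>
    have h1 := map_sum (FiniteField.frobeniusAlgHom k' k)
      (fun j => x j ^ Nat.card k' ^ i * algebraMap k' k (c j)) Finset.univ
    simp only [map_mul, AlgHom.commutes, FiniteField.coe_frobeniusAlgHom,
      ← Nat.card_eq_fintype_card] at h1
    rw [pow_succ, pow_mul, ih, h1]
    exact Finset.sum_congr rfl fun j _ => by rw [← pow_mul]

theorem frobeniusForm_pow [Finite k'] (α : Module.Basis (Fin n) k' k) (i : ℕ) :
    frobeniusForm (Nat.card k') α i ^ Nat.card k' =
      ∑ j, MvPolynomial.C (α j ^ Nat.card k' ^ (i + 1)) * MvPolynomial.X j ^ Nat.card k' := by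
  have := Fintype.ofFinite k'
  have h1 := map_sum (FiniteField.frobeniusAlgHom k' (MvPolynomial (Fin n) k))
    (fun j => MvPolynomial.C (α j ^ Nat.card k' ^ i) * MvPolynomial.X j) Finset.univ
  simp only [FiniteField.coe_frobeniusAlgHom] at h1
  rw [frobeniusForm, Nat.card_eq_fintype_card] at *
  rw [h1]
  exact Finset.sum_congr rfl fun j _ => by rw [mul_pow, ← MvPolynomial.C_pow, ← pow_mul, pow_succ]

theorem eval_frobeniusForm [Finite k'] (α : Module.Basis (Fin n) k' k) (i : ℕ) (v : Fin n → k') :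
    MvPolynomial.eval (fun j => algebraMap k' k (v j)) (frobeniusForm (Nat.card k') α i) =
      (∑ j, v j • α j) ^ Nat.card k' ^ i := by
  simp only [frobeniusForm, map_sum, map_mul, MvPolynomial.eval_C, MvPolynomial.eval_X]
  rw [← sum_smul_pow_card]
  congr 1
  exact Finset.sum_congr rfl fun j _ => by rw [Algebra.smul_def, mul_comm]

/-- Substitution of the linear forms `∑ j, α_j ^ (q ^ i) X_j`. -/
noncomputable def frobeniusSubst (q : ℕ) (α : Module.Basis (Fin n) k' k) :
    MvPolynomial (Fin n) k →ₐ[k] MvPolynomial (Fin n) k :=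
  MvPolynomial.aeval fun i : Fin n => frobeniusForm q α i

/-- The inverse substitution `X_j ↦ ∑ i, β_j ^ (q ^ i) X_i`, for the trace dual basis `β`. -/
noncomputable def traceSubst [Finite k] (q : ℕ) (α : Module.Basis (Fin n) k' k) :
    MvPolynomial (Fin n) k →ₐ[k] MvPolynomial (Fin n) k :=
  have := Module.Finite.of_basis α
  MvPolynomial.aeval fun j : Fin n =>
    ∑ i : Fin n, MvPolynomial.C (α.traceDual j ^ q ^ (i : ℕ)) * MvPolynomial.X i

theorem sum_pow_card_eq_trace [Finite k] (α : Module.Basis (Fin n) k' k) (x : k) :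
    ∑ i : Fin n, x ^ Nat.card k' ^ (i : ℕ) = algebraMap k' k (Algebra.trace k' k x) := by
  rw [FiniteField.algebraMap_trace_eq_sum_pow, Module.finrank_eq_card_basis α, Fintype.card_fin,
    Finset.sum_range]

theorem totalDegree_frobeniusSubst_le (q : ℕ) (α : Module.Basis (Fin n) k' k)
    (p : MvPolynomial (Fin n) k) : (frobeniusSubst q α p).totalDegree ≤ p.totalDegree :=
  totalDegree_aeval_le (fun _ => totalDegree_sum_C_mul_X_le _) p

theorem totalDegree_traceSubst_le [Finite k] (q : ℕ) (α : Module.Basis (Fin n) k' k)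
    (p : MvPolynomial (Fin n) k) : (traceSubst q α p).totalDegree ≤ p.totalDegree :=
  totalDegree_aeval_le (fun _ => totalDegree_sum_C_mul_X_le _) p

/-- The product of the two coefficient matrices has entries ∑_i (β_j α_l)^{q^i} = Tr(β_j α_l) =
δ_{jl}. -/
theorem frobeniusSubst_traceSubst [Finite k'] [Finite k] (α : Module.Basis (Fin n) k' k) (p : MvPolynomial (Fin n) k) :
    frobeniusSubst (Nat.card k') α (traceSubst (Nat.card k') α p) = p := by
  have := Module.Finite.of_basis α
  suffices H : (frobeniusSubst (Nat.card k') α).comp (traceSubst (Nat.card k') α) =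
      AlgHom.id k _ from DFunLike.congr_fun H p
  refine MvPolynomial.algHom_ext fun j => ?_
  simp only [AlgHom.comp_apply, traceSubst, MvPolynomial.aeval_X, map_sum, map_mul, AlgHom.id_apply,
    frobeniusSubst, MvPolynomial.algHom_C, MvPolynomial.algebraMap_eq]
  simp only [frobeniusForm, Finset.mul_sum]
  rw [Finset.sum_comm]
  simp only [← mul_assoc, ← MvPolynomial.C_mul, ← mul_pow, ← Finset.sum_mul, ← map_sum,
    sum_pow_card_eq_trace α, Module.Basis.trace_traceDual_mul]
  simp

/-- Substituting the coordinates of `x` amounts to evaluating at `x`. -/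
theorem eval_ascend_traceSubst_map [Finite k'] [Finite k] (α : Module.Basis (Fin n) k' k) (p : MvPolynomial (Fin n) k')
    (x : k) : (ascend k (Nat.card k') n (traceSubst (Nat.card k') α
      (MvPolynomial.map (algebraMap k' k) p))).eval x =
        algebraMap k' k (MvPolynomial.eval (α.repr x) p) := by
  have := Module.Finite.of_basis α
  induction p using MvPolynomial.induction_on with
  | C a =>
    simp [MvPolynomial.algHom_C, MvPolynomial.algebraMap_eq, Polynomial.algebraMap_eq]
  | add p r hp hr => simp only [map_add, Polynomial.eval_add, hp, hr]
  | mul_X p j hp =>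
    simp only [map_mul, Polynomial.eval_mul, hp, MvPolynomial.map_X, MvPolynomial.eval_X]
    congr 1
    simp only [traceSubst, MvPolynomial.aeval_X, map_sum, map_mul, ascend_X, MvPolynomial.algHom_C,
      Polynomial.algebraMap_eq, Polynomial.eval_finsetSum, Polynomial.eval_mul, Polynomial.eval_C,
      Polynomial.eval_pow, Polynomial.eval_X, ← mul_pow]
    rw [sum_pow_card_eq_trace α]
    congr 1
    conv_lhs => rw [← α.sum_repr x]
    simp only [Finset.mul_sum, mul_smul_comm, map_sum, map_smul, Module.Basis.trace_traceDual_mul]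
    simp

/-- X_i^q - X_{i+1} is sent to ∑ α_j^{q^{i+1}} (X_j^q - X_j). At the wrap-around this uses α_j^{q^n}
= α_j. -/
theorem V_twistedFieldEquations_le_comap [Finite k'] [Finite k] [NeZero n] {q N : ℕ} (hq : Nat.card k' = q)
    (hk : Nat.card k = q ^ n) (hN : q ≤ N) (α : Module.Basis (Fin n) k' k) :
    V (twistedFieldEquations k (fun i : Fin n => i + 1) q) N ≤
      (V (fieldEquations (Fin n) k q) N).comap (frobeniusSubst q α).toLinearMap := by
  subst hq
  refine V_le ?_ ((closedUpTo_V _ _).comap fun _ => totalDegree_sum_C_mul_X_le _)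
  rintro _ ⟨i, rfl⟩ -
  rw [Submodule.mem_comap, AlgHom.toLinearMap_apply, map_sub, map_pow]
  simp only [frobeniusSubst, MvPolynomial.aeval_X]
  have h1 : frobeniusForm (Nat.card k') α ((i + 1 : Fin n) : ℕ) =
      frobeniusForm (Nat.card k') α (i + 1) := by
    rcases Nat.lt_or_ge (i + 1) n with h | h
    · rw [Fin.val_add_one_of_lt' h]
    · have hi : (i : ℕ) + 1 = n := by have := i.isLt; omega
      have h0 : ((i + 1 : Fin n) : ℕ) = 0 := by
        rw [Fin.val_add, Fin.val_one', Nat.add_mod_mod, hi, Nat.mod_self]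
      have := Fintype.ofFinite k
      simp only [frobeniusForm, h0, hi, ← hk, Nat.card_eq_fintype_card, FiniteField.pow_card,
        pow_zero, pow_one]
  rw [h1, frobeniusForm_pow, frobeniusForm, ← Finset.sum_sub_distrib]
  refine sum_mem fun j _ => ?_
  rw [← mul_sub, MvPolynomial.C_mul']
  refine Submodule.smul_mem _ _ (mem_V_of_mem ⟨j, rfl⟩ ?_)
  have : 0 < Nat.card k' := Nat.card_pos
  refine (MvPolynomial.totalDegree_sub _ _).trans (max_le ?_ ?_)
  · rwa [MvPolynomial.totalDegree_X_pow]
  · rw [MvPolynomial.totalDegree_X]; omega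

end Coordinates

end WeilDescent

namespace WeilDescent

/-! ### Comparing the Weil descent system with descended polynomials -/

section Descent

variable {k k' : Type*} [Field k'] [Field k] [Algebra k' k] {n : ℕ}

/-- As a divisor of X^{#k} - X, m splits over `k` with simple roots, so containment of root sets
gives divisibility. -/
theorem dvd_of_eval_eq_zero [Finite k] {m P : Polynomial k}
    (hm : m ∣ Polynomial.X ^ Nat.card k - Polynomial.X)
    (h : ∀ x, m.eval x = 0 → P.eval x = 0) : m ∣ P := by
  have := Fintype.ofFinite k
  rw [Nat.card_eq_fintype_card] at hm
  have hX := FiniteField.X_pow_card_sub_X_ne_zero k (Fintype.one_lt_card (α := k))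
  have hm0 : m ≠ 0 := ne_zero_of_dvd_ne_zero hX hm
  rcases eq_or_ne P 0 with rfl | hP
  · exact dvd_zero m
  have hsplit : (Polynomial.X ^ Fintype.card k - Polynomial.X : Polynomial k).Splits := by
    rw [Polynomial.splits_iff_card_roots, FiniteField.roots_X_pow_card_sub_X,
      FiniteField.X_pow_card_sub_X_natDegree_eq k Fintype.one_lt_card]
    rfl
  have hnodup : m.roots.Nodup := by
    refine Multiset.nodup_of_le (Polynomial.roots.le_of_dvd hX hm) ?_
    rw [FiniteField.roots_X_pow_card_sub_X]
    exact Finset.univ.nodup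
  refine (hsplit.of_dvd hX hm).dvd_of_roots_le_roots hm0 ?_
  rw [Multiset.le_iff_subset hnodup]
  intro x hx
  rw [Polynomial.mem_roots hm0] at hx
  rw [Polynomial.mem_roots hP]
  exact h x hx

theorem eval_eq_zero_of_mem_span_fieldEquations [Finite k'] {p : MvPolynomial (Fin n) k}
    (hp : p ∈ Ideal.span (fieldEquations (Fin n) k (Nat.card k'))) (v : Fin n → k') :
    MvPolynomial.eval (fun i => algebraMap k' k (v i)) p = 0 := by
  have := Fintype.ofFinite k'
  rw [← RingHom.mem_ker]
  refine (Ideal.span_le.mpr ?_) hp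
  rintro _ ⟨i, rfl⟩
  simp only [SetLike.mem_coe, RingHom.mem_ker, map_sub, map_pow, MvPolynomial.eval_X]
  rw [← map_pow, Nat.card_eq_fintype_card, FiniteField.pow_card, sub_self]

/-- The polynomial `∑ j, [f]_j α_j`. -/
noncomputable def weilSum (α : Module.Basis (Fin n) k' k) (c : Fin n → MvPolynomial (Fin n) k') :
    MvPolynomial (Fin n) k :=
  ∑ j, MvPolynomial.C (α j) * MvPolynomial.map (algebraMap k' k) (c j)

theorem eval_weilSum (α : Module.Basis (Fin n) k' k) (c : Fin n → MvPolynomial (Fin n) k')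
    (v : Fin n → k') : MvPolynomial.eval (fun i => algebraMap k' k (v i)) (weilSum α c) =
      ∑ j, MvPolynomial.eval v (c j) • α j := by
  rw [weilSum, map_sum]
  refine Finset.sum_congr rfl fun i _ => ?_
  rw [map_mul, MvPolynomial.eval_C, Algebra.smul_def, mul_comm, MvPolynomial.eval_map]
  congr 1
  exact (MvPolynomial.eval₂_comp_left (algebraMap k' k) (RingHom.id k') v (c i)).symm

theorem IsWeilComponents.sum_eval_smul [Finite k'] {α : Module.Basis (Fin n) k' k} {f : Polynomial k}
    {c : Fin n → MvPolynomial (Fin n) k'} (hc : IsWeilComponents α f c) (v : Fin n → k') :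
    ∑ j, MvPolynomial.eval v (c j) • α j = f.eval (∑ j, v j • α j) := by
  have h1 := eval_eq_zero_of_mem_span_fieldEquations hc.congr v
  rw [map_sub, sub_eq_zero, ← weilSum, eval_weilSum] at h1
  rw [← h1, substBasis, Polynomial.aeval_def, Polynomial.hom_eval₂, MvPolynomial.algebraMap_eq,
    show (MvPolynomial.eval fun i => algebraMap k' k (v i)).comp MvPolynomial.C = RingHom.id k from
      RingHom.ext fun a => MvPolynomial.eval_C a]
  change _ = Polynomial.eval₂ (RingHom.id k) _ f
  congr 1
  rw [map_sum]
  exact Finset.sum_congr rfl fun j _ => by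
    rw [map_mul, MvPolynomial.eval_C, MvPolynomial.eval_X, Algebra.smul_def, mul_comm]

theorem coeff_weilSum (α : Module.Basis (Fin n) k' k) (c : Fin n → MvPolynomial (Fin n) k')
    (s : Fin n →₀ ℕ) : (weilSum α c).coeff s = ∑ j, (c j).coeff s • α j := by
  simp only [weilSum, MvPolynomial.coeff_sum, MvPolynomial.coeff_C_mul, MvPolynomial.coeff_map,
    Algebra.smul_def, mul_comm]

/-- Linear independence of the α_j rules out cancellation between components. -/
theorem totalDegree_le_totalDegree_weilSum (α : Module.Basis (Fin n) k' k)
    (c : Fin n → MvPolynomial (Fin n) k') (j : Fin n) :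
    (c j).totalDegree ≤ (weilSum α c).totalDegree := by
  refine Finset.sup_le fun s hs => MvPolynomial.le_totalDegree ?_
  rw [MvPolynomial.mem_support_iff] at hs ⊢
  intro h
  rw [coeff_weilSum] at h
  exact hs (Fintype.linearIndependent_iff.mp α.linearIndependent _ h j)

theorem weilSum_mem_restrictDegree (α : Module.Basis (Fin n) k' k)
    {c : Fin n → MvPolynomial (Fin n) k'} {N : ℕ} (hc : ∀ i j, (c j).degreeOf i ≤ N) :
    weilSum α c ∈ MvPolynomial.restrictDegree (Fin n) k N := by
  rw [MvPolynomial.mem_restrictDegree]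
  intro s hs i
  rw [MvPolynomial.mem_support_iff, coeff_weilSum] at hs
  obtain ⟨j, -, hj⟩ := Finset.exists_ne_zero_of_sum_ne_zero hs
  refine MvPolynomial.degreeOf_le_iff.mp (hc i j) s ?_
  rw [MvPolynomial.mem_support_iff]
  exact fun h => hj (by rw [h, zero_smul])

/-- Although the coefficients lie in `k`, degrees below #k' in each variable make the grid k'^n
large enough to determine the polynomial. -/
theorem eq_of_reduced_of_eval_eq [Finite k'] {p r : MvPolynomial (Fin n) k}
    (hp : p ∈ MvPolynomial.restrictDegree (Fin n) k (Nat.card k' - 1))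
    (hr : r ∈ MvPolynomial.restrictDegree (Fin n) k (Nat.card k' - 1))
    (h : ∀ v : Fin n → k', MvPolynomial.eval (fun i => algebraMap k' k (v i)) p =
      MvPolynomial.eval (fun i => algebraMap k' k (v i)) r) : p = r := by
  classical
  have := Fintype.ofFinite k'
  refine sub_eq_zero.mp (MvPolynomial.eq_zero_of_eval_zero_at_prod_finset _
    (fun _ => Finset.univ.image (algebraMap k' k)) (fun i => ?_) fun x hx => ?_)
  · rw [Finset.card_image_of_injective _ (algebraMap k' k).injective, Finset.card_univ,
      ← Nat.card_eq_fintype_card]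
    have h1 : (p - r).degreeOf i ≤ Nat.card k' - 1 := by
      rw [MvPolynomial.degreeOf_le_iff]
      exact fun s hs => (MvPolynomial.mem_restrictDegree _ _ _).mp (sub_mem hp hr) s hs i
    have h2 : 0 < Nat.card k' := Nat.card_pos
    omega
  · simp only [Finset.mem_image, Finset.mem_univ, true_and] at hx
    choose v hv using hx
    obtain rfl : (fun i => algebraMap k' k (v i)) = x := funext hv
    rw [map_sub, h, sub_self]

theorem eval_ascend_descend [Finite k] [NeZero n] {q : ℕ} (hk : Nat.card k = q ^ n) (f : Polynomial k)
    (x : k) : (ascend k q n (descend k q n f)).eval x = f.eval x := by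
  have := Fintype.ofFinite k
  have h : 1 < q ^ n := hk ▸ Finite.one_lt_card
  obtain ⟨a, ha⟩ := dvd_sub_ascend_descend h f
  have h1 := congrArg (Polynomial.eval x) ha
  rw [Polynomial.eval_sub, Polynomial.eval_mul, Polynomial.eval_sub, Polynomial.eval_pow,
    Polynomial.eval_X, ← hk, Nat.card_eq_fintype_card, FiniteField.pow_card, sub_self,
    zero_mul] at h1
  exact (sub_eq_zero.mp h1).symm

theorem eval_frobeniusSubst [Finite k'] (α : Module.Basis (Fin n) k' k) (p : MvPolynomial (Fin n) k)
    (v : Fin n → k') :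
    MvPolynomial.eval (fun i => algebraMap k' k (v i)) (frobeniusSubst (Nat.card k') α p) =
      (ascend k (Nat.card k') n p).eval (∑ j, v j • α j) := by
  induction p using MvPolynomial.induction_on with
  | C a => simp [MvPolynomial.algHom_C, MvPolynomial.algebraMap_eq, Polynomial.algebraMap_eq]
  | add p r hp hr => simp only [map_add, Polynomial.eval_add, hp, hr]
  | mul_X p i hp =>
    simp only [map_mul, Polynomial.eval_mul, hp]
    congr 1
    rw [frobeniusSubst, MvPolynomial.aeval_X, eval_frobeniusForm, ascend_X, Polynomial.eval_pow,
      Polynomial.eval_X]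

/-- The Weil sum of `f` is the reduced form of `f̄` in the original coordinates. -/
theorem totalDegree_weilSum_le_and_sub_mem [Finite k'] [Finite k] [NeZero n] (hk : Nat.card k = Nat.card k' ^ n)
    {α : Module.Basis (Fin n) k' k} {f : Polynomial k} {c : Fin n → MvPolynomial (Fin n) k'}
    (hc : IsWeilComponents α f c) {N : ℕ}
    (hN : (descend k (Nat.card k') n f).totalDegree ≤ N) :
    (weilSum α c).totalDegree ≤ N ∧
      frobeniusSubst (Nat.card k') α (descend k (Nat.card k') n f) - weilSum α c ∈
        V (fieldEquations (Fin n) k (Nat.card k')) N := by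
  -- For π = id the relations are the ordinary field equations.
  obtain ⟨r, hr, hrN, hsub⟩ := exists_reduced_sub_mem_V (π := id) (q := Nat.card k')
    Finite.one_lt_card ((totalDegree_frobeniusSubst_le (Nat.card k') α _).trans hN)
  have h1 : r = weilSum α c := by
    refine eq_of_reduced_of_eval_eq hr (weilSum_mem_restrictDegree α hc.reduced) fun v => ?_
    have h2 := eval_eq_zero_of_mem_span_fieldEquations (V_le_span _ _ hsub) v
    rw [map_sub, sub_eq_zero, eval_frobeniusSubst, eval_ascend_descend hk] at h2
    rw [← h2, eval_weilSum, hc.sum_eval_smul]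
  exact ⟨h1 ▸ hrN, h1 ▸ hsub⟩

theorem fieldEquations_subset_image_map [Finite k'] (α : Module.Basis (Fin n) k' k) (F : Set (Polynomial k)) :
    fieldEquations (Fin n) k (Nat.card k') ⊆
      MvPolynomial.map (algebraMap k' k) '' weilDescentWithFieldEquations α F := by
  rintro _ ⟨j, rfl⟩
  exact ⟨_, Or.inr ⟨j, rfl⟩, by simp⟩

theorem frobeniusSubst_descend_mem_V [Finite k'] [Finite k] [NeZero n] (hk : Nat.card k = Nat.card k' ^ n)
    (α : Module.Basis (Fin n) k' k) {F : Set (Polynomial k)} {g : Polynomial k} (hg : g ∈ F)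
    {N : ℕ} (hN : (descend k (Nat.card k') n g).totalDegree ≤ N) :
    frobeniusSubst (Nat.card k') α (descend k (Nat.card k') n g) ∈
      V (MvPolynomial.map (algebraMap k' k) '' weilDescentWithFieldEquations α F) N := by
  obtain ⟨h1, h2⟩ := totalDegree_weilSum_le_and_sub_mem hk (weilComponent_spec α g) hN
  rw [← sub_add_cancel (frobeniusSubst _ _ _) (weilSum α (weilComponent α g))]
  refine add_mem (V_mono (fieldEquations_subset_image_map α F) le_rfl h2) (sum_mem fun j _ => ?_)
  rw [MvPolynomial.C_mul']
  refine Submodule.smul_mem _ _ (mem_V_of_mem ⟨_, Or.inl ⟨g, hg, j, rfl⟩, rfl⟩ ?_)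
  rw [totalDegree_map_algebraMap]
  exact (totalDegree_le_totalDegree_weilSum α _ j).trans h1

theorem eval_eq_zero_of_mem_span_weilDescent [Finite k'] {α : Module.Basis (Fin n) k' k}
    {F : Set (Polynomial k)} {x : k} (hx : ∀ g ∈ F, g.eval x = 0)
    {f : MvPolynomial (Fin n) k'} (hf : f ∈ Ideal.span (weilDescentWithFieldEquations α F)) :
    MvPolynomial.eval (α.repr x) f = 0 := by
  have := Fintype.ofFinite k'
  rw [← RingHom.mem_ker]
  refine (Ideal.span_le.mpr ?_) hf
  rintro _ (⟨g, hg, j, rfl⟩ | ⟨j, rfl⟩)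
  · have h1 := (weilComponent_spec α g).sum_eval_smul (α.repr x)
    rw [α.sum_repr, hx g hg] at h1
    exact Fintype.linearIndependent_iff.mp α.linearIndependent _ h1 j
  · simp only [SetLike.mem_coe, RingHom.mem_ker, map_sub, map_pow, MvPolynomial.eval_X]
    rw [Nat.card_eq_fintype_card, FiniteField.pow_card, sub_self]

/-- For t = 1 and r = 2d the logarithm in τ is log_q d. The left side is an integer with ⌊log_q d⌋
in its place, so it survives the outer floor. -/
theorem two_mul_le_tau {q d : ℕ} (hq : 2 ≤ q) :
    2 * (if d = 0 then 0 else (q - 1) * (Nat.log q d + 1)) ≤ tau (2 * d) q 1 := by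
  split_ifs with hd
  · simp
  · rw [tau, if_neg (by omega), Int.le_toNat (le_max_right _ _)]
    refine le_max_of_le_left (Int.le_floor.mpr ?_)
    have h1 := Real.natLog_le_logb d q
    have h2 : ((2 * d : ℕ) : ℝ) / (2 * ((1 : ℕ) : ℝ)) = d := by push_cast; ring
    have h3 : (0 : ℝ) ≤ (q : ℝ) - 1 := by
      have : (2 : ℝ) ≤ q := by exact_mod_cast hq
      linarith
    rw [h2]
    push_cast [Nat.cast_sub (by omega : 1 ≤ q)]
    nlinarith

end Descent

end WeilDescent

/-! ### The bound on the last fall degree -/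

theorem mainTheorem2 {k k' : Type*} [Field k'] [Finite k'] [Field k] [Finite k] [Algebra k' k]
    (q n : ℕ) (hq : Nat.card k' = q) (hk : Nat.card k = q ^ n)
    (α : Module.Basis (Fin n) k' k)
    (F : Set (Polynomial k)) (hF : F.Finite) (d : ℕ)
    (hd : ∃ f ∈ F, f ≠ 0 ∧ f.natDegree ≤ d)
    (hdesc : ∀ g ∈ F, (WeilDescent.descended q n g).totalDegree ≤ WeilDescent.tau (2 * d) q 1) :
    WeilDescent.lastFallDegree (WeilDescent.weilDescentWithFieldEquations α F) ≤
      ((max (WeilDescent.tau (2 * d) q 1) q : ℕ) : ℕ∞) := by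
  open WeilDescent in
  subst hq
  have hq2 : 2 ≤ Nat.card k' := Finite.one_lt_card
  have hn : NeZero n := ⟨by
    rintro rfl
    have : 1 < Nat.card k := Finite.one_lt_card
    rw [hk, pow_zero] at this
    exact lt_irrefl _ this⟩
  have h1 : 1 < Nat.card k' ^ n := hk ▸ Finite.one_lt_card
  set q := Nat.card k' with hqdef
  set D := max (tau (2 * d) q 1) q with hD
  set T := if d = 0 then 0 else (q - 1) * (Nat.log q d + 1) with hT
  set G := MvPolynomial.map (algebraMap k' k) '' weilDescentWithFieldEquations α F with hG
  have hτ : 2 * T ≤ tau (2 * d) q 1 := two_mul_le_tau hq2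
  have hτD : tau (2 * d) q 1 ≤ D := le_max_left _ _
  have hqD : q ≤ D := le_max_right _ _
  let W : ℕ → Submodule k (MvPolynomial (Fin n) k) := fun N =>
    (V G N).comap (frobeniusSubst q α).toLinearMap
  have hclosed : ∀ N, ClosedUpTo (W N) N := fun N =>
    (closedUpTo_V G N).comap fun _ => totalDegree_sum_C_mul_X_le _
  have hrel : ∀ N, D ≤ N → V (twistedFieldEquations k (fun i : Fin n => i + 1) q) N ≤ W N :=
    fun N hN => (V_twistedFieldEquations_le_comap rfl hk (hqD.trans hN) α).trans
      (Submodule.comap_mono (V_mono (fieldEquations_subset_image_map α F) le_rfl))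
  have hFW : ∀ g ∈ F, descend k q n g ∈ W D := fun g hg =>
    frobeniusSubst_descend_mem_V hk α hg ((hdesc g hg).trans hτD)
  obtain ⟨f₀, hf₀F, hf₀, hf₀d⟩ := hd
  -- T + 1 ≤ D follows from 2T ≤ D when T ≥ 1, and from 2 ≤ q ≤ D when T = 0.
  obtain ⟨m, hm, hmX, hmF⟩ := exists_isDivisorOf hq2 hqD (hclosed D) (hrel D le_rfl)
    (fun p hp => totalDegree_descend_le h1 hp) (hτ.trans hτD) (by omega) hf₀ hf₀d (hFW f₀ hf₀F)
  refine sInf_le ⟨D, fun f hf => mem_V_of_map_mem_V (k := k) ?_, rfl⟩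
  set N := max D f.totalDegree
  have hDN : D ≤ N := le_max_left _ _
  set p := traceSubst q α (MvPolynomial.map (algebraMap k' k) f) with hp
  have hpN : p.totalDegree ≤ N := by
    refine (totalDegree_traceSubst_le q α _).trans ?_
    rw [totalDegree_map_algebraMap]
    exact le_max_right _ _
  -- A root x of m is a common zero of F, so f vanishes at the coordinates of x, which is the value
  -- of the univariate image at x.
  have hmp : m ∣ ascend k q n p := by
    refine dvd_of_eval_eq_zero (hk ▸ hmX) fun x hx => ?_
    rw [hp, eval_ascend_traceSubst_map, eval_eq_zero_of_mem_span_weilDescent ?_ hf, map_zero]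
    intro g hg
    exact Polynomial.eval_eq_zero_of_dvd_of_eval_eq_zero
      (hmF g ((hdesc g hg).trans hτD) (hFW g hg)) hx
  -- The m found in degree D still serves in the larger degree N, where p has remainder 0.
  have h2 := (hm.mono hDN (hclosed N) (Submodule.comap_mono (V_mono subset_rfl hDN))
    (hrel N hDN)).sub_descend_ascend_mod_mem hpN
  rw [EuclideanDomain.mod_eq_zero.mpr hmp, map_zero, sub_zero, Submodule.mem_comap,
    AlgHom.toLinearMap_apply, hp, frobeniusSubst_traceSubst] at h2
  exact h2
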